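/- Theorem. Let $p$ be a prime, let $K$ be a field of characteristic $p$, and let $v$ be a (Krull) valuation on $K$, written additively, of arbitrary rank and possibly trivial, with maximal ideal $\mathcal{M}_v=\{x\in K : v(x)>0\}$. Let $K(p)$ be the compositum, inside an algebraic closure of $K$, of all finite Galois extensions of $K$ whose degree is a power of $p$. Call $(K,v)$ $p$-henselian if $v$ has, up to equivalence of valuations, exactly one extension to $K(p)$. Then $$(K,v)\text{ is }p\text{-henselian}\quad\Longleftrightarrow\quad \mathcal{M}_v\subseteq\{x^p-x : x\in K\}.$$ -/

import Mathlib

/-- `K(p)`: the compositum, inside a fixed algebraic closure of `K`, of all finite Galois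
extensions of `K` whose degree is a power of `p`. -/
noncomputable def maximalPExtension (p : ℕ) (K : Type*) [Field K] :
    IntermediateField K (AlgebraicClosure K) :=
  sSup {E | FiniteDimensional K E ∧ IsGalois K E ∧ ∃ n : ℕ, Module.finrank K E = p ^ n}

/-- A valued field `(K, v)` is `p`-henselian if `v` extends uniquely to `K(p)`. Valuations on
`K(p)` are taken up to equivalence, i.e. they are given by their valuation rings `W`, and
`v.HasExtension W.valuation` says that the restriction to `K` of the valuation with ring `W`
is equivalent to `v`. -/
def IsPHenselian (p : ℕ) {K Γ₀ : Type*} [Field K] [LinearOrderedCommGroupWithZero Γ₀]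
    (v : Valuation K Γ₀) : Prop :=
  ∃! W : ValuationSubring (maximalPExtension p K), v.HasExtension W.valuation

/-! If `v` extends uniquely to `W` on K(p), then `W` is Galois-stable. For v(a) > 0 let θ be a root
of X^p - X - a. The product of the θ - j over j in F_p is a, so some θ - j lies in the maximal ideal
of `W`, and so do its conjugates θ - j + c. Then c does too, which forces c = 0, so θ lies in K.

Conversely, let `W` lie over `v` in a finite Galois p-extension, with decomposition group D ≠ G.
Some nonzero χ : G → F_p kills D. Weak approximation gives a D-invariant unit y of `W` whose
conjugates outside D are small; weighted traces of y yield θ in the maximal ideal with gθ = θ + χ(g)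
(`exists_lt_one_smul_eq_add`). Now θ^p - θ lies in the maximal ideal of `v`, hence equals b^p - b
with b in K. So θ - b is in F_p, θ is in K and χ = 0, a contradiction. Thus extensions are
Galois-stable, and a norm argument shows that stable extensions coincide. -/

open Pointwise

/-! ### Approximation by geometric sums -/

open Finset in
/-- In residue characteristic `p`, for a suitable number `m + 1 > 1` of terms the truncated geometric
series in `z` is a unit at every valuation which is integral at `z`; one `m` works for all
multiples. -/
theorem Valuation.exists_geom_sum_eq_one {E Γ : Type*} [Field E]
    [LinearOrderedCommGroupWithZero Γ] (p : ℕ) [Fact p.Prime] [CharP E p]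
    (w : Valuation E Γ) (z : E) (hz : w z ≤ 1) :
    ∃ n : ℕ, 0 < n ∧ ∀ m, n ∣ m → 0 < m → w (∑ i ∈ range (m + 1), z ^ i) = 1 := by
  have hp : p.Prime := Fact.out
  have hpow (i : ℕ) : w (z ^ i) ≤ 1 := by rw [map_pow]; exact pow_le_one' hz i
  have hsum (k : ℕ) : w (∑ i ∈ range k, z ^ i) ≤ 1 := w.map_sum_le fun i _ ↦ hpow i
  have hsub (k : ℕ) : w (z ^ k - 1) ≤ 1 :=
    (w.map_sub _ _).trans (max_le (hpow k) w.map_one.le)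
  by_cases h : ∃ n, 0 < n ∧ w (z ^ n - 1) < 1
  · obtain ⟨n, hn, hzn⟩ := h
    -- The sum is 1 + z * S, with S of length m a multiple of p * n, and S is small: if z ≡ 1 then S
    -- ≡ m = 0, by the factor p; otherwise z - 1 is a unit and (z - 1) * S = z ^ m - 1 is small, by
    -- the factor n.
    refine ⟨p * n, Nat.mul_pos hp.pos hn, ?_⟩
    rintro _ ⟨l, rfl⟩ _
    rw [geom_sum_succ, add_comm]
    apply w.map_one_add_of_lt
    rw [map_mul]
    refine mul_lt_one_of_nonneg_of_lt_one_right hz zero_le ?_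
    have hm : w (z ^ (p * n * l) - 1) < 1 := by
      have : z ^ (p * n * l) - 1 = (z ^ n - 1) * ∑ i ∈ range (p * l), (z ^ n) ^ i := by
        rw [mul_geom_sum, ← pow_mul]; congr 2; ring
      rw [this, map_mul]
      refine mul_lt_one_of_lt_of_le hzn (w.map_sum_le fun i _ ↦ ?_)
      rw [← pow_mul]; exact hpow _
    rcases (hsub 1).lt_or_eq with h1 | h1
    · rw [pow_one] at h1
      have : ∑ i ∈ range (p * n * l), z ^ i = ∑ i ∈ range (p * n * l), (z ^ i - 1) := by
        simp [Finset.sum_sub_distrib]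
      rw [this]
      refine w.map_sum_lt one_ne_zero fun i _ ↦ ?_
      rw [← mul_geom_sum, map_mul]
      exact mul_lt_one_of_lt_of_le h1 (hsum i)
    · rw [pow_one] at h1
      rw [← mul_geom_sum, map_mul, h1, one_mul] at hm
      exact hm
  · push Not at h
    have h' (n : ℕ) (hn : 0 < n) : w (z ^ n - 1) = 1 := (hsub n).antisymm (h n hn)
    refine ⟨1, one_pos, fun m _ _ ↦ ?_⟩
    have := h' (m + 1) m.succ_pos
    rw [← mul_geom_sum, map_mul] at this
    have h1 := h' 1 one_pos
    rw [pow_one] at h1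
    rwa [h1, one_mul] at this

open Finset in
theorem Valuation.map_geom_sum_gt_one {E Γ : Type*} [Field E]
    [LinearOrderedCommGroupWithZero Γ] (w : Valuation E Γ) {z : E} (hz : 1 < w z) {m : ℕ}
    (hm : 0 < m) : 1 < w (∑ i ∈ range (m + 1), z ^ i) := by
  have : ∀ m : ℕ, w (∑ i ∈ range (m + 1), z ^ i) = w z ^ m := by
    intro m
    induction m with
    | zero => simp
    | succ m ih =>
      rw [geom_sum_succ, w.map_add_eq_of_lt_left, map_mul, ih, pow_succ']
      rw [map_mul, ih, map_one, ← pow_succ']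
      exact one_lt_pow' hz (by simp)
  rw [this]
  exact one_lt_pow' hz hm.ne'

/-- Given finitely many valuations on a field of characteristic `p` and an element `z`, there is an
element integral at all of them, which is a unit where `z` is integral, and has positive value
where `z` has a pole. -/
theorem Valuation.exists_forall_le_one_of_finite {E Γ ι : Type*} [Field E] [Finite ι]
    [LinearOrderedCommGroupWithZero Γ] (p : ℕ) [Fact p.Prime] [CharP E p]
    (w : ι → Valuation E Γ) (z : E) :
    ∃ e : E, ∀ i, (w i z ≤ 1 → w i e = 1) ∧ (1 < w i z → w i e < 1) := by
  cases nonempty_fintype ι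
  have H (i : ι) : ∃ n : ℕ, 0 < n ∧ (w i z ≤ 1 → ∀ m, n ∣ m → 0 < m →
      w i (∑ i ∈ Finset.range (m + 1), z ^ i) = 1) := by
    by_cases hi : w i z ≤ 1
    · obtain ⟨n, hn, h⟩ := (w i).exists_geom_sum_eq_one p z hi
      exact ⟨n, hn, fun _ ↦ h⟩
    · exact ⟨1, one_pos, fun h ↦ absurd h hi⟩
  choose n hn h using H
  have hpos : 0 < ∏ i, n i := Finset.prod_pos fun i _ ↦ hn i
  refine ⟨(∑ j ∈ Finset.range (∏ i, n i + 1), z ^ j)⁻¹, fun i ↦ ⟨fun hi ↦ ?_, fun hi ↦ ?_⟩⟩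
  · rw [map_inv₀, h i hi _ (Finset.dvd_prod_of_mem n (Finset.mem_univ i)) hpos, inv_one]
  · rw [map_inv₀]
    exact inv_lt_one_of_one_lt₀ ((w i).map_geom_sum_gt_one hi hpos)

/-- A proper subgroup of a finite `p`-group is killed by a nontrivial character to `ℤ/p`. -/
theorem IsPGroup.exists_hom_zmod {G : Type*} [Group G] [Finite G] {p : ℕ} [Fact p.Prime]
    (hG : IsPGroup p G) {D : Subgroup G} (hD : D ≠ ⊤) :
    ∃ χ : G →* Multiplicative (ZMod p), D ≤ χ.ker ∧ χ ≠ 1 := by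
  have hp : p.Prime := Fact.out
  obtain ⟨n, hn⟩ := IsPGroup.iff_card.mp hG
  obtain ⟨k, hk⟩ := IsPGroup.iff_card.mp (hG.to_subgroup D)
  have hkn : k < n := by
    by_contra! h
    apply hD
    apply Subgroup.eq_top_of_le_card
    rw [hn, hk]
    exact Nat.pow_le_pow_right hp.pos h
  -- D lies in a subgroup of index p, which is normal because p is the least prime factor of the
  -- group order.
  obtain ⟨H, hH, hDH⟩ := Sylow.exists_subgroup_card_pow_prime_le p
    (hn ▸ pow_dvd_pow p (Nat.sub_le n 1)) D hk (Nat.le_sub_one_of_lt hkn)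
  have hidx : H.index = p := by
    have := H.card_mul_index
    rw [hH, hn] at this
    have h2 : p ^ n = p ^ (n - 1) * p := by rw [← pow_succ]; congr 1; omega
    rw [h2] at this
    exact Nat.eq_of_mul_eq_mul_left (pow_pos hp.pos _) this
  have : H.Normal := Subgroup.normal_of_index_eq_minFac_card (by
    rw [hidx, hn, hp.pow_minFac (by omega)])
  have hcard : Nat.card (G ⧸ H) = p := hidx
  let e : G ⧸ H ≃* Multiplicative (ZMod p) := mulEquivOfPrimeCardEq (p := p) hcard (by simp)
  have hker : (e.toMonoidHom.comp (QuotientGroup.mk' H)).ker = H := by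
    ext g; simp
  refine ⟨e.toMonoidHom.comp (QuotientGroup.mk' H), hker.symm ▸ hDH, fun h ↦ ?_⟩
  rw [h, MonoidHom.ker_one] at hker
  rw [← hker, Subgroup.index_top] at hidx
  exact hp.one_lt.ne hidx

/-! ### Decomposition groups and the additive cocycle -/

namespace ValuationSubring

variable {G E : Type*} [Group G] [Field E] [MulSemiringAction G E]

/-- The chain W ≤ gW ≤ g²W ≤ ... returns to W because g has finite order. -/
theorem smul_eq_of_le_smul [Finite G] {W : ValuationSubring E} {g : G} (h : W ≤ g • W) :
    g • W = W := by
  have hpow : ∀ n : ℕ, W ≤ g ^ n • W := by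
    intro n
    induction n with
    | zero => simp
    | succ n ih =>
      rw [pow_succ', mul_smul]
      exact h.trans (pointwise_smul_le_pointwise_smul_iff.mpr ih)
  refine le_antisymm ?_ h
  have hn : orderOf g - 1 + 1 = orderOf g := Nat.sub_add_cancel (orderOf_pos g)
  calc g • W ≤ g • g ^ (orderOf g - 1) • W := pointwise_smul_le_pointwise_smul_iff.mpr (hpow _)
    _ = W := by rw [← mul_smul, ← pow_succ', hn, pow_orderOf_eq_one, one_smul]

theorem valuation_smul_le_one_iff {W : ValuationSubring E} {g : G} {x : E} :
    W.valuation (g • x) ≤ 1 ↔ x ∈ g⁻¹ • W := by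
  rw [valuation_le_one_iff, mem_inv_pointwise_smul_iff]

theorem valuation_smul_lt_one (W : ValuationSubring E) {g : G} (hg : g • W = W) {x : E}
    (hx : W.valuation x < 1) : W.valuation (g • x) < 1 := by
  rw [← mem_nonunits_iff, mem_nonunits_iff_or] at hx ⊢
  rcases hx with rfl | hx
  · exact Or.inl (smul_zero g)
  · refine Or.inr ?_
    rwa [← smul_inv'', ← hg, smul_mem_pointwise_smul_iff]

theorem valuation_smul_eq_one (W : ValuationSubring E) {g : G} (hg : g • W = W) {x : E}
    (hx : W.valuation x = 1) : W.valuation (g • x) = 1 := by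
  refine le_antisymm ?_ (not_lt.mp fun h ↦ ?_)
  · rw [valuation_smul_le_one_iff, inv_smul_eq_iff.mpr hg.symm, ← valuation_le_one_iff, hx]
  · have := W.valuation_smul_lt_one (inv_smul_eq_iff.mpr hg.symm) h
    rw [inv_smul_smul, hx] at this
    exact this.false

theorem exists_lt_one_and_one_lt_smul [Finite G] {W : ValuationSubring E} {g : G}
    (hg : g • W ≠ W) : ∃ z : E, W.valuation z < 1 ∧ 1 < W.valuation (g • z) := by
  have h1 : ¬ W ≤ g • W := fun h ↦ hg (smul_eq_of_le_smul h)
  have h2 : ¬ W ≤ g⁻¹ • W := fun h ↦ hg (by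
    conv_lhs => rw [← smul_eq_of_le_smul h]
    rw [smul_inv_smul])
  obtain ⟨b, hb, hb'⟩ := SetLike.not_le_iff_exists.mp h1
  obtain ⟨a, ha, ha'⟩ := SetLike.not_le_iff_exists.mp h2
  rw [mem_inv_pointwise_smul_iff, ← valuation_le_one_iff, not_le] at ha'
  rw [mem_pointwise_smul_iff_inv_smul_mem, ← valuation_le_one_iff, not_le] at hb'
  rw [← valuation_le_one_iff] at ha hb
  -- Both a and b lie in W, while g • a and g⁻¹ • b have poles.
  refine ⟨a / (g⁻¹ • b), ?_, ?_⟩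
  · rw [map_div₀, div_lt_one₀ (zero_lt_one.trans hb')]
    exact ha.trans_lt hb'
  · have hb0 : W.valuation b ≠ 0 := by
      rw [Valuation.ne_zero_iff]
      rintro rfl
      simp at hb'
    rw [smul_div₀', smul_inv_smul, map_div₀, one_lt_div₀ (zero_lt_iff.mpr hb0)]
    exact hb.trans_lt ha'

theorem exists_unit_smul_lt_one [Finite G] (p : ℕ) [Fact p.Prime] [CharP E p]
    (W : ValuationSubring E) :
    ∃ x : E, W.valuation x = 1 ∧ ∀ g : G, g • W ≠ W → W.valuation (g • x) < 1 := by
  classical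
  cases nonempty_fintype G
  have H (g : G) : ∃ e : E, W.valuation e = 1 ∧ (∀ h : G, W.valuation (h • e) ≤ 1) ∧
      (g • W ≠ W → W.valuation (g • e) < 1) := by
    by_cases hg : g • W = W
    · exact ⟨1, by simp, by simp, fun h ↦ absurd hg h⟩
    · obtain ⟨z, hz, hgz⟩ := exists_lt_one_and_one_lt_smul hg
      obtain ⟨e, he⟩ := Valuation.exists_forall_le_one_of_finite p
        (fun h : G ↦ W.valuation.comap (MulSemiringAction.toRingHom G E h)) z
      refine ⟨e, by simpa using (he 1).1 (by simpa using hz.le), fun h ↦ ?_,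
        fun _ ↦ (he g).2 hgz⟩
      rcases le_or_gt (W.valuation (h • z)) 1 with h' | h'
      · exact ((he h).1 h').le
      · exact ((he h).2 h').le
  choose e he1 he hlt using H
  refine ⟨∏ g, e g, by simp [he1], fun g hg ↦ ?_⟩
  rw [Finset.smul_prod', map_prod, ← Finset.mul_prod_erase _ _ (Finset.mem_univ g)]
  exact mul_lt_one_of_lt_of_le (hlt g hg) (Finset.prod_le_one' fun h _ ↦ he h g)

/-- Take the product of the conjugates of x under the stabilizer D: for g outside D every gd is
outside D, so each factor stays small. -/
theorem exists_unit_fixed_smul_lt_one [Finite G] (p : ℕ) [Fact p.Prime] [CharP E p]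
    (W : ValuationSubring E) :
    ∃ y : E, W.valuation y = 1 ∧ (∀ g : G, g • W = W → g • y = y) ∧
      ∀ g : G, g • W ≠ W → W.valuation (g • y) < 1 := by
  classical
  obtain ⟨x, hx, hlt⟩ := exists_unit_smul_lt_one (G := G) p W
  cases nonempty_fintype (MulAction.stabilizer G W)
  refine ⟨∏ d : MulAction.stabilizer G W, d • x, ?_, fun g hg ↦ ?_, fun g hg ↦ ?_⟩
  · rw [map_prod]
    exact Finset.prod_eq_one fun d _ ↦ W.valuation_smul_eq_one d.2 hx
  · rw [Finset.smul_prod']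
    exact Fintype.prod_equiv (Equiv.mulLeft (⟨g, hg⟩ : MulAction.stabilizer G W)) _ _
      fun d ↦ (mul_smul g (d : G) x).symm
  · rw [Finset.smul_prod', map_prod]
    have h (d : MulAction.stabilizer G W) : W.valuation (g • d • x) < 1 := by
      have hd : (d : G) • W = W := d.2
      have := hlt (g * d) (by rwa [mul_smul, hd])
      rwa [mul_smul] at this
    rw [← Finset.mul_prod_erase _ _ (Finset.mem_univ 1)]
    exact mul_lt_one_of_lt_of_le (h 1) (Finset.prod_le_one' fun d _ ↦ (h d).le)

theorem zmod_cast_mem (p : ℕ) [Fact p.Prime] [CharP E p] (W : ValuationSubring E) (c : ZMod p) :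
    ZMod.castHom dvd_rfl E c ∈ W := by
  rw [← ZMod.natCast_zmod_val c, map_natCast]
  exact natCast_mem W _

/-- If `χ` is trivial on the decomposition group of `W`, then the cocycle `g ↦ χ g` is the
coboundary of an element of the maximal ideal of `W`. -/
theorem exists_lt_one_smul_eq_add [Finite G] (p : ℕ) [Fact p.Prime] [CharP E p]
    (W : ValuationSubring E) (χ : G →* Multiplicative (ZMod p))
    (hχ : MulAction.stabilizer G W ≤ χ.ker) :
    ∃ θ : E, W.valuation θ < 1 ∧
      ∀ g : G, g • θ = θ + ZMod.castHom dvd_rfl E (χ g).toAdd := by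
  classical
  obtain ⟨y, hy, hfix, hlt⟩ := exists_unit_fixed_smul_lt_one (G := G) p W
  let D := MulAction.stabilizer G W
  cases nonempty_fintype (G ⧸ D)
  let c : G → E := fun g ↦ ZMod.castHom dvd_rfl E (χ g).toAdd
  have hc (g h : G) : c (g * h) = c g + c h := by simp [c]
  have hgc (g h : G) : g • c h = c h := RingHom.congr_fun (Subsingleton.elim
    ((MulSemiringAction.toRingHom G E g).comp (ZMod.castHom dvd_rfl E))
    (ZMod.castHom dvd_rfl E)) (χ h).toAdd
  have hcW (g : G) : W.valuation (c g) ≤ 1 :=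
    (W.valuation_le_one_iff _).mpr (zmod_cast_mem p W _)
  have hcD (d : G) (hd : d ∈ D) : c d = 0 := by
    have : χ d = 1 := hχ hd
    simp [c, this]
  have hout (g : G) (q : G ⧸ D) : ∃ d ∈ D, (g • q).out = g * q.out * d := by
    obtain ⟨d, hd⟩ := QuotientGroup.mk_out_eq_mul D (g * q.out)
    refine ⟨d, d.2, ?_⟩
    rw [← hd]
    congr 1
    conv_lhs => rw [← q.out_eq']
    rfl
  have hyout (g : G) (q : G ⧸ D) : (g • q).out • y = g • q.out • y := by
    obtain ⟨d, hd, h⟩ := hout g q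
    rw [h, mul_smul, mul_smul, hfix d hd]
  have hcout (g : G) (q : G ⧸ D) : c (g • q).out = c g + c q.out := by
    obtain ⟨d, hd, h⟩ := hout g q
    rw [h, hc, hc, hcD d hd, add_zero]
  have hmem (q : G ⧸ D) (hq : q.out ∈ D) : q = (1 : G) := by
    rw [← q.out_eq']
    exact QuotientGroup.eq.mpr (by rw [mul_one]; exact D.inv_mem hq)
  -- Since y and χ are insensitive to D, these sums do not depend on the representatives: t is
  -- invariant and g sends s to s - χ(g)t. The trivial coset contributes a unit to t and zero to s,
  -- so -s / t is small.
  let t : E := ∑ q : G ⧸ D, q.out • y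
  let s : E := ∑ q : G ⧸ D, c q.out * q.out • y
  have hgt (g : G) : g • t = t := by
    simp only [t, Finset.smul_sum]
    exact Fintype.sum_equiv (MulAction.toPerm g) _ _ fun q ↦ (hyout g q).symm
  have hgs (g : G) : g • s = s - c g * t := by
    have h1 : s = ∑ q : G ⧸ D, c (g • q).out * (g • q).out • y :=
      (Fintype.sum_equiv (MulAction.toPerm g) _ _ fun q ↦ rfl).symm
    have h2 : g • s = ∑ q : G ⧸ D, c q.out * g • q.out • y := by
      simp only [s, Finset.smul_sum, smul_mul']
      refine Finset.sum_congr rfl fun q _ ↦ ?_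
      congr 1
      exact hgc g _
    have h3 : t = ∑ q : G ⧸ D, g • q.out • y := by
      rw [← Finset.smul_sum]; exact (hgt g).symm
    rw [h2, h1, h3, Finset.mul_sum, ← Finset.sum_sub_distrib]
    refine Finset.sum_congr rfl fun q _ ↦ ?_
    rw [hcout, hyout]; ring
  have hlt' (q : G ⧸ D) (hq : q ≠ (1 : G)) : W.valuation (q.out • y) < 1 :=
    hlt _ fun h ↦ hq (hmem q h)
  have hq1 : ((1 : G) : G ⧸ D).out ∈ D := by
    obtain ⟨d, hd⟩ := QuotientGroup.mk_out_eq_mul D 1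
    rw [hd, one_mul]
    exact d.2
  have hwt : W.valuation t = 1 := by
    simp only [t]
    rw [← Finset.add_sum_erase _ _ (Finset.mem_univ ((1 : G) : G ⧸ D)), hfix _ hq1,
      Valuation.map_add_eq_of_lt_left, hy]
    rw [hy]
    exact Valuation.map_sum_lt _ one_ne_zero fun q hq ↦ hlt' q (Finset.ne_of_mem_erase hq)
  have hws : W.valuation s < 1 := by
    refine Valuation.map_sum_lt _ one_ne_zero fun q _ ↦ ?_
    by_cases hq : q = (1 : G)
    · rw [hq, hcD _ hq1, zero_mul, map_zero]
      exact zero_lt_one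
    · rw [map_mul]
      exact mul_lt_one_of_nonneg_of_lt_one_right (hcW _) zero_le (hlt' q hq)
  have ht0 : t ≠ 0 := by
    intro h
    simp [h] at hwt
  refine ⟨-s / t, by rwa [map_div₀, Valuation.map_neg, hwt, div_one], fun g ↦ ?_⟩
  change g • (-s / t) = -s / t + c g
  rw [smul_div₀', smul_neg, hgs, hgt]
  field_simp
  ring

end ValuationSubring

/-! ### Stability, uniqueness and existence of extensions -/

theorem ZMod.exists_castHom_eq_of_pow_eq_self {E : Type*} [Field E] (p : ℕ) [Fact p.Prime]
    [CharP E p] {x : E} (hx : x ^ p = x) : ∃ c : ZMod p, ZMod.castHom dvd_rfl E c = x := by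
  have h : (⊥ : Subfield E) ≤ (ZMod.castHom dvd_rfl E : ZMod p →+* E).fieldRange := bot_le
  exact h ((Subfield.mem_bot_iff_pow_eq_self (F := E) (p := p)).mpr hx)

theorem ZMod.castHom_pow_self {E : Type*} [Field E] (p : ℕ) [Fact p.Prime]
    [CharP E p] (c : ZMod p) :
    ZMod.castHom dvd_rfl E c ^ p = ZMod.castHom dvd_rfl E c := by
  rw [← map_pow, ZMod.pow_card]

/-- If the maximal ideal of `v` consists of elements `x ^ p - x`, then in a finite Galois
`p`-extension every extension of `v` is fixed by the Galois group. -/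
theorem ValuationSubring.smul_eq_of_forall_exists_pow_sub {K Γ₀ E : Type*} [Field K]
    [LinearOrderedCommGroupWithZero Γ₀] (p : ℕ) [Fact p.Prime] [CharP K p] (v : Valuation K Γ₀)
    [Field E] [Algebra K E] [FiniteDimensional K E] [IsGalois K E]
    (hG : IsPGroup p Gal(E/K))
    (hv : ∀ a, v a < 1 → ∃ b, b ^ p - b = a)
    (W : ValuationSubring E) (hW : ∀ a, v a ≤ 1 → algebraMap K E a ∈ W)
    (σ : Gal(E/K)) : σ • W = W := by
  have : CharP E p := charP_of_injective_algebraMap (algebraMap K E).injective p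
  suffices MulAction.stabilizer Gal(E/K) W = ⊤ from
    (this.symm ▸ Subgroup.mem_top σ : σ ∈ MulAction.stabilizer Gal(E/K) W)
  by_contra hD
  obtain ⟨χ, hχ, hne⟩ := hG.exists_hom_zmod hD
  obtain ⟨θ, hθ, hθσ⟩ := W.exists_lt_one_smul_eq_add p χ hχ
  have hfix : θ ^ p - θ ∈ (⊥ : IntermediateField K E) := by
    refine (IsGalois.mem_bot_iff_fixed _).mpr fun g ↦ ?_
    have := hθσ g
    rw [AlgEquiv.smul_def] at this
    rw [map_sub, map_pow, this, add_pow_char, ZMod.castHom_pow_self]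
    ring
  obtain ⟨a, ha⟩ := IntermediateField.mem_bot.mp hfix
  have hlt : W.valuation (θ ^ p - θ) < 1 := by
    refine (W.valuation.map_sub _ _).trans_lt (max_lt ?_ hθ)
    rw [map_pow]
    exact pow_lt_one₀ zero_le hθ (Fact.out : p.Prime).ne_zero
  -- If v a ≥ 1, then a⁻¹ would lie in W, contradicting the positivity of a at W.
  obtain ⟨b, hb⟩ := hv a (by
    by_contra! h
    have h' := (W.valuation_le_one_iff _).mpr
      (hW a⁻¹ (by rw [map_inv₀]; exact inv_le_one_of_one_le₀ h))
    rw [← ha, ← inv_inv (algebraMap K E a), map_inv₀, ← map_inv₀ (algebraMap K E)] at hlt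
    refine (one_le_inv₀ (zero_lt_iff.mpr ?_) |>.mpr h').not_gt hlt
    intro h0
    simp only [map_eq_zero, inv_eq_zero] at h0
    simp [h0] at h)
  obtain ⟨c, hc⟩ := ZMod.exists_castHom_eq_of_pow_eq_self p (x := θ - algebraMap K E b) (by
    rw [sub_pow_char, ← map_pow]
    rw [← hb, map_sub] at ha
    linear_combination -ha)
  apply hne
  ext g
  have h1 := hθσ g
  have h2 : g • θ = θ := by
    rw [← sub_add_cancel θ (algebraMap K E b), ← hc, smul_add, smul_algebraMap]
    congr 1
    exact RingHom.congr_fun (Subsingleton.elim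
      ((MulSemiringAction.toRingHom Gal(E/K) E g).comp (ZMod.castHom dvd_rfl E))
      (ZMod.castHom dvd_rfl E)) c
  rw [h2, left_eq_add, map_eq_zero] at h1
  exact h1

/-- If x were in W₁ but not in W₂, the same would hold for all its conjugates, hence for its norm,
which comes from K. -/
theorem ValuationSubring.le_of_forall_smul_eq {K E : Type*} [Field K]
    [Field E] [Algebra K E] [FiniteDimensional K E] [IsGalois K E] {W₁ W₂ : ValuationSubring E}
    (h₂ : ∀ σ : Gal(E/K), σ • W₂ = W₂) (h₁ : ∀ σ : Gal(E/K), σ • W₁ = W₁)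
    (h : ∀ a : K, algebraMap K E a ∈ W₁ → algebraMap K E a ∈ W₂) : W₁ ≤ W₂ := by
  classical
  intro x hx
  by_contra hx₂
  have hmem : algebraMap K E (Algebra.norm K x) ∈ W₁ := by
    rw [Algebra.norm_eq_prod_automorphisms]
    refine prod_mem fun σ _ ↦ ?_
    rw [← h₁ σ]
    exact smul_mem_pointwise_smul σ x W₁ hx
  refine (((W₂.valuation_le_one_iff _).mpr (h _ hmem)).trans_lt ?_).false
  have hlt (σ : Gal(E/K)) : 1 < W₂.valuation (σ x) := by
    rw [← not_le, valuation_le_one_iff, ← h₂ σ, ← AlgEquiv.smul_def, smul_mem_pointwise_smul_iff]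
    exact hx₂
  rw [Algebra.norm_eq_prod_automorphisms, map_prod]
  rw [← Finset.mul_prod_erase _ _ (Finset.mem_univ 1)]
  exact one_lt_mul_of_lt_of_le' (hlt 1) (Finset.one_le_prod' fun σ _ ↦ (hlt σ).le)

/-- Chevalley's extension theorem for valuations of fields. -/
theorem Valuation.exists_hasExtension {K Γ₀ : Type*} [Field K]
    [LinearOrderedCommGroupWithZero Γ₀] (v : Valuation K Γ₀) (N : Type*) [Field N] [Algebra K N] :
    ∃ W : ValuationSubring N, v.HasExtension W.valuation := by
  let f : v.valuationSubring →+* N := (algebraMap K N).comp v.valuationSubring.subtype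
  obtain ⟨W, hW, hloc⟩ := IsLocalRing.exists_factor_valuationRing f
  refine ⟨W, Valuation.HasExtension.ofComapInteger ?_⟩
  ext a
  rw [Subring.mem_comap, Valuation.mem_integer_iff, Valuation.mem_integer_iff]
  refine ⟨fun ha ↦ ?_, fun ha ↦ (W.valuation_le_one_iff _).mpr (hW ⟨a, ha⟩)⟩
  by_contra! hlt
  have ha0 : a ≠ 0 := by
    rintro rfl
    simp at hlt
  have hinv : v a⁻¹ < 1 := by
    rw [map_inv₀]; exact inv_lt_one_of_one_lt₀ hlt
  let b : v.valuationSubring := ⟨a⁻¹, hinv.le⟩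
  -- The nonunit a⁻¹ would become a unit in W, against locality of the map.
  have hu : IsUnit (f.codRestrict W.toSubring hW b) := by
    refine IsUnit.of_mul_eq_one ⟨algebraMap K N a, (W.valuation_le_one_iff _).mp ha⟩ ?_
    apply Subtype.ext
    change algebraMap K N a⁻¹ * algebraMap K N a = 1
    rw [← map_mul, inv_mul_cancel₀ ha0, map_one]
  obtain ⟨u, hu⟩ := hloc.map_nonunit b hu
  have h1 : a⁻¹ * ((u⁻¹ : v.valuationSubringˣ) : v.valuationSubring) = 1 := by
    have := congrArg Subtype.val (u.mul_inv)
    rw [hu] at this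
    exact this
  have h2 := congrArg v h1
  rw [map_mul, map_one] at h2
  refine (mul_lt_one_of_lt_of_le hinv ?_).ne h2
  exact ((u⁻¹ : v.valuationSubringˣ) : v.valuationSubring).2

/-! ### Finite p-extensions and their compositum -/

section PExtension

variable {p : ℕ} {K L : Type*} [Field K] [Field L] [Algebra K L]

theorem IntermediateField.mem_fixedField_zpowers_iff {x : L} (τ : Gal(L/K)) :
    x ∈ fixedField (Subgroup.zpowers τ) ↔ τ x = x := by
  rw [mem_fixedField_iff]
  refine ⟨fun h ↦ h τ (Subgroup.mem_zpowers τ), fun h σ hσ ↦ ?_⟩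
  have : Subgroup.zpowers τ ≤ MulAction.stabilizer Gal(L/K) x := by
    rwa [Subgroup.zpowers_le]
  exact this hσ

theorem IntermediateField.le_fixedField_zpowers_iff (E : IntermediateField K L) (τ : Gal(L/K)) :
    E ≤ fixedField (Subgroup.zpowers τ) ↔ ∀ x ∈ E, τ x = x := by
  simp only [← mem_fixedField_zpowers_iff, SetLike.le_def]

/-- Phrasing the condition through automorphisms of L reduces composita to inclusions in fixed
fields. -/
theorem isPGroup_gal_iff [Normal K L] (E : IntermediateField K L) [Normal K E] :
    IsPGroup p Gal(E/K) ↔ ∀ τ : Gal(L/K), ∃ n : ℕ, ∀ x ∈ E, (τ ^ p ^ n) x = x := by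
  have key (τ : Gal(L/K)) (n : ℕ) : AlgEquiv.restrictNormalHom E τ ^ p ^ n = 1 ↔
      ∀ x ∈ E, (τ ^ p ^ n) x = x := by
    rw [← map_pow]
    exact AlgEquiv.restrictNormal_eq_one_iff E _
  refine ⟨fun h τ ↦ ?_, fun h σ ↦ ?_⟩
  · obtain ⟨n, hn⟩ := h (AlgEquiv.restrictNormalHom E τ)
    exact ⟨n, (key τ n).mp hn⟩
  · obtain ⟨τ, rfl⟩ := AlgEquiv.restrictNormalHom_surjective (F := K) (K₁ := E) L σ
    obtain ⟨n, hn⟩ := h τ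
    exact ⟨n, (key τ n).mpr hn⟩

theorem isPGroup_gal_sup [Normal K L] (E F : IntermediateField K L) [Normal K E] [Normal K F]
    (hE : IsPGroup p Gal(E/K)) (hF : IsPGroup p Gal(F/K)) :
    IsPGroup p Gal((E ⊔ F : IntermediateField K L)/K) := by
  rw [isPGroup_gal_iff] at hE hF ⊢
  intro τ
  obtain ⟨m, hm⟩ := hE τ
  obtain ⟨n, hn⟩ := hF (τ ^ p ^ m)
  refine ⟨m + n, ?_⟩
  rw [pow_add, pow_mul, ← IntermediateField.le_fixedField_zpowers_iff]
  refine sup_le ?_ ?_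
  · rw [← IntermediateField.le_fixedField_zpowers_iff] at hm
    refine hm.trans (IntermediateField.fixedField_antitone ?_)
    rw [Subgroup.zpowers_le]
    exact Subgroup.pow_mem _ (Subgroup.mem_zpowers _) _
  · rwa [IntermediateField.le_fixedField_zpowers_iff]

theorem isPGroup_gal_iff_finrank [Fact p.Prime] [FiniteDimensional K L] [IsGalois K L] :
    IsPGroup p Gal(L/K) ↔ ∃ n, Module.finrank K L = p ^ n := by
  rw [IsPGroup.iff_card, IsGalois.card_aut_eq_finrank]

end PExtension

section MaximalPExtension

variable {p : ℕ} [Fact p.Prime] {K : Type*} [Field K]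

theorem le_maximalPExtension (E : IntermediateField K (AlgebraicClosure K))
    [FiniteDimensional K E] [IsGalois K E] (h : IsPGroup p Gal(E/K)) :
    E ≤ maximalPExtension p K :=
  le_sSup ⟨inferInstance, inferInstance, isPGroup_gal_iff_finrank.mp h⟩

/-- K(x) is compact in the lattice of intermediate fields, and finite Galois p-extensions are
directed under compositum. -/
theorem exists_mem_of_mem_maximalPExtension {x : AlgebraicClosure K}
    (hx : x ∈ maximalPExtension p K) :
    ∃ E : IntermediateField K (AlgebraicClosure K), FiniteDimensional K E ∧ IsGalois K E ∧
      IsPGroup p Gal(E/K) ∧ E ≤ maximalPExtension p K ∧ x ∈ E := by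
  have hc := (CompleteLattice.isCompactElement_iff_le_of_directed_sSup_le _ _).mp
    (IntermediateField.adjoin_simple_isCompactElement (F := K) x) _ ?_ ?_
    (IntermediateField.adjoin_simple_le_iff.mpr hx)
  · obtain ⟨E, ⟨h1, h2, h3⟩, hxE⟩ := hc
    have h := isPGroup_gal_iff_finrank.mpr h3
    exact ⟨E, h1, h2, h, le_maximalPExtension E h, IntermediateField.adjoin_simple_le_iff.mp hxE⟩
  · exact ⟨⊥, inferInstance, inferInstance, 0, by simp⟩
  · rintro E ⟨_, _, hE⟩ F ⟨_, _, hF⟩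
    rw [← isPGroup_gal_iff_finrank] at hE hF
    have : IsGalois K (E ⊔ F : IntermediateField K (AlgebraicClosure K)) := ⟨⟩
    exact ⟨E ⊔ F, ⟨inferInstance, inferInstance,
      isPGroup_gal_iff_finrank.mp (isPGroup_gal_sup E F hE hF)⟩, le_sup_left, le_sup_right⟩

instance isGalois_maximalPExtension : IsGalois K (maximalPExtension p K) := by
  unfold maximalPExtension
  rw [sSup_eq_iSup']
  have (E : {E : IntermediateField K (AlgebraicClosure K) | FiniteDimensional K E ∧
    IsGalois K E ∧ ∃ n : ℕ, Module.finrank K E = p ^ n}) : IsGalois K E.1 := E.2.2.1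
  exact ⟨⟩

end MaximalPExtension

/-! ### Artin–Schreier roots -/

section ArtinSchreier

variable {p : ℕ} {K L : Type*} [Field K] [Field L] [Algebra K L]

theorem isSeparable_of_pow_sub_self_eq [CharP K p] {θ : L} {a : K} (h : θ ^ p - θ = algebraMap K L a) :
    IsSeparable K θ := by
  open Polynomial in
  have hsep : (X ^ p - X - C a : K[X]).Separable := by
    rw [Polynomial.separable_def]
    have : derivative (X ^ p - X - C a : K[X]) = -1 := by simp [Polynomial.derivative_X_pow]
    rw [this]
    exact isCoprime_one_right.neg_right
  refine Polynomial.Separable.of_dvd hsep (minpoly.dvd K θ ?_)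
  simp [h]

theorem exists_zmod_algEquiv_eq_add [Fact p.Prime] [CharP L p] {θ : L} {a : K}
    (h : θ ^ p - θ = algebraMap K L a) (σ : Gal(L/K)) :
    ∃ c : ZMod p, σ θ = θ + ZMod.castHom dvd_rfl L c := by
  obtain ⟨c, hc⟩ := ZMod.exists_castHom_eq_of_pow_eq_self p (x := σ θ - θ) (by
    have h1 := congrArg σ h
    rw [AlgEquiv.commutes, map_sub, map_pow] at h1
    rw [sub_pow_char]
    linear_combination h1 - h)
  exact ⟨c, by rw [hc]; ring⟩

theorem algEquiv_zmod_cast [CharP L p] (σ : Gal(L/K)) (c : ZMod p) :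
    σ (ZMod.castHom dvd_rfl L c) = ZMod.castHom dvd_rfl L c :=
  RingHom.congr_fun (Subsingleton.elim
    ((σ : L →+* L).comp (ZMod.castHom dvd_rfl L)) (ZMod.castHom dvd_rfl L)) c

/-- Artin-Schreier roots lie in the maximal `p`-extension. -/
theorem mem_maximalPExtension_of_pow_sub_self_eq [Fact p.Prime] [CharP K p]
    {θ : AlgebraicClosure K} {a : K}
    (h : θ ^ p - θ = algebraMap K _ a) : θ ∈ maximalPExtension p K := by
  have : CharP (AlgebraicClosure K) p := charP_of_injective_algebraMap (algebraMap K _).injective p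
  have hsep := isSeparable_of_pow_sub_self_eq h
  have := IntermediateField.adjoin.finiteDimensional hsep.isIntegral
  have : Algebra.IsSeparable K (IntermediateField.adjoin K {θ}) :=
    (IntermediateField.isSeparable_adjoin_simple_iff_isSeparable _ _).mpr hsep
  have hθ := IntermediateField.mem_adjoin_simple_self K θ
  have : Normal K (IntermediateField.adjoin K {θ}) := by
    rw [IntermediateField.normal_iff_forall_map_le']
    intro σ
    rw [IntermediateField.adjoin_map, Set.image_singleton,
      IntermediateField.adjoin_simple_le_iff]
    obtain ⟨c, hc⟩ := exists_zmod_algEquiv_eq_add h σ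
    change σ θ ∈ _
    rw [hc, ← ZMod.natCast_zmod_val c, map_natCast]
    exact add_mem hθ (natCast_mem _ _)
  have : IsGalois K (IntermediateField.adjoin K {θ}) := ⟨⟩
  refine le_maximalPExtension _ ?_ hθ
  rw [isPGroup_gal_iff]
  intro τ
  refine ⟨1, ?_⟩
  obtain ⟨c, hc⟩ := exists_zmod_algEquiv_eq_add h τ
  -- Taking n = p kills the translation, so τ ^ p fixes θ.
  have hpow (n : ℕ) : (τ ^ n) θ = θ + n * ZMod.castHom dvd_rfl (AlgebraicClosure K) c := by
    induction n with
    | zero => simp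
    | succ n ih =>
      rw [pow_succ', AlgEquiv.mul_apply, ih, map_add, hc, map_mul, map_natCast,
        algEquiv_zmod_cast]
      push_cast
      ring
  rw [← IntermediateField.le_fixedField_zpowers_iff, IntermediateField.adjoin_simple_le_iff,
    IntermediateField.mem_fixedField_zpowers_iff, hpow, pow_one, CharP.cast_eq_zero, zero_mul,
    add_zero]

end ArtinSchreier

/-! ### The two implications -/

theorem Valuation.hasExtension_valuation_iff {K Γ₀ N : Type*} [Field K] [Field N] [Algebra K N]
    [LinearOrderedCommGroupWithZero Γ₀] {v : Valuation K Γ₀} {W : ValuationSubring N} :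
    v.HasExtension W.valuation ↔ ∀ a, algebraMap K N a ∈ W ↔ v a ≤ 1 := by
  refine ⟨fun h a ↦ ?_, fun h ↦ .ofComapInteger ?_⟩
  · rw [← W.valuation_le_one_iff, HasExtension.val_map_le_one_iff v]
  · ext a
    rw [Subring.mem_comap, mem_integer_iff, mem_integer_iff, W.valuation_le_one_iff, h]

open Polynomial in
theorem ZMod.prod_sub_castHom {E : Type*} [Field E] (p : ℕ) [Fact p.Prime] [CharP E p] (x : E) :
    ∏ c : ZMod p, (x - ZMod.castHom dvd_rfl E c) = x ^ p - x := by
  have hp : p.Prime := Fact.out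
  have hroots : (X ^ p - X : (ZMod p)[X]).roots = Finset.univ.val := by
    simpa [ZMod.card] using FiniteField.roots_X_pow_card_sub_X (ZMod p)
  have hdeg := FiniteField.X_pow_card_sub_X_natDegree_eq (ZMod p) hp.one_lt
  have hmonic : (X ^ p - X : (ZMod p)[X]).Monic :=
    monic_X_pow_sub (by simpa using hp.one_lt)
  have := prod_multiset_X_sub_C_of_monic_of_roots_card_eq hmonic (by
    rw [hroots, hdeg]; simp [ZMod.card])
  rw [hroots] at this
  have h2 := congrArg (eval₂ (ZMod.castHom dvd_rfl E) x) this
  change eval₂ _ x (∏ c : ZMod p, (X - C c)) = _ at h2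
  simpa [eval₂_finsetProd] using h2

theorem exists_pow_sub_self_eq_of_isPHenselian {p : ℕ} [Fact p.Prime] {K Γ₀ : Type*} [Field K]
    [CharP K p] [LinearOrderedCommGroupWithZero Γ₀] {v : Valuation K Γ₀} (h : IsPHenselian p v)
    {a : K} (ha : v a < 1) : ∃ x : K, x ^ p - x = a := by
  obtain ⟨W, hW, huniq⟩ := h
  have : CharP (maximalPExtension p K) p :=
    charP_of_injective_algebraMap (algebraMap K _).injective p
  have hstab (σ : Gal(maximalPExtension p K/K)) : σ • W = W := by
    refine huniq _ (Valuation.hasExtension_valuation_iff.mpr fun b ↦ ?_)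
    rw [ValuationSubring.mem_pointwise_smul_iff_inv_smul_mem, smul_algebraMap]
    exact Valuation.hasExtension_valuation_iff.mp hW b
  obtain ⟨θ, hθ⟩ : ∃ θ : maximalPExtension p K, θ ^ p - θ = algebraMap K _ a := by
    open Polynomial in
    obtain ⟨θ, hθ⟩ := IsAlgClosed.exists_aeval_eq_zero (AlgebraicClosure K)
      (X ^ p - X - C a : K[X]) fun hdeg ↦ by
        have := natDegree_eq_of_degree_eq_some hdeg
        rw [natDegree_sub_C, FiniteField.X_pow_card_sub_X_natDegree_eq K
          (Fact.out : p.Prime).one_lt] at this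
        exact (Fact.out : p.Prime).ne_zero this
    have hθ' : θ ^ p - θ = algebraMap K _ a := by
      simpa [sub_eq_zero] using hθ
    exact ⟨⟨θ, mem_maximalPExtension_of_pow_sub_self_eq hθ'⟩, Subtype.ext hθ'⟩
  obtain ⟨j, hj⟩ : ∃ j : ZMod p, W.valuation (θ - ZMod.castHom dvd_rfl _ j) < 1 := by
    by_contra! hle
    have h1 := Finset.one_le_prod' fun (j : ZMod p) (_ : j ∈ Finset.univ) ↦ hle j
    rw [← map_prod, ZMod.prod_sub_castHom, hθ] at h1
    exact h1.not_gt ((Valuation.HasExtension.val_map_lt_one_iff v _ a).mpr ha)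
  have hbot : θ ∈ (⊥ : IntermediateField K (maximalPExtension p K)) := by
    refine (InfiniteGalois.mem_bot_iff_fixed _).mpr fun σ ↦ ?_
    obtain ⟨c, hc⟩ := exists_zmod_algEquiv_eq_add hθ σ
    by_contra hne
    have hc0 : c ≠ 0 := by
      rintro rfl
      exact hne (by simpa using hc)
    have hj' : W.valuation (σ (θ - ZMod.castHom dvd_rfl _ j)) < 1 :=
      W.valuation_smul_lt_one (hstab σ) hj
    rw [map_sub, algEquiv_zmod_cast, hc] at hj'
    -- c is the difference of σ(θ - j) and θ - j, both small; but a nonzero element of F_p is a unit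
    -- of W.
    have hlt : W.valuation (ZMod.castHom dvd_rfl (maximalPExtension p K) c) < 1 := by
      have := (W.valuation.map_sub _ _).trans_lt (max_lt hj' hj)
      convert this using 2
      ring
    have hle := (W.valuation_le_one_iff _).mpr (W.zmod_cast_mem p c⁻¹)
    have h1 := mul_lt_one_of_lt_of_le hlt hle
    rw [← map_mul, ← map_mul, mul_inv_cancel₀ hc0, map_one, map_one] at h1
    exact h1.false
  obtain ⟨x, hx⟩ := IntermediateField.mem_bot.mp hbot
  refine ⟨x, (algebraMap K (maximalPExtension p K)).injective ?_⟩
  rw [map_sub, map_pow, hx, hθ]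

theorem isPHenselian_of_forall_exists_pow_sub_self_eq {p : ℕ} [Fact p.Prime] {K Γ₀ : Type*}
    [Field K] [CharP K p] [LinearOrderedCommGroupWithZero Γ₀] {v : Valuation K Γ₀}
    (h : ∀ a, v a < 1 → ∃ x : K, x ^ p - x = a) : IsPHenselian p v := by
  have hle (W₁ W₂ : ValuationSubring (maximalPExtension p K)) (h₁ : v.HasExtension W₁.valuation)
      (h₂ : v.HasExtension W₂.valuation) : W₁ ≤ W₂ := by
    rw [Valuation.hasExtension_valuation_iff] at h₁ h₂
    intro x hx
    obtain ⟨E, _, _, hE, hEN, hxE⟩ := exists_mem_of_mem_maximalPExtension x.2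
    let f : E →+* maximalPExtension p K := (IntermediateField.inclusion hEN : E →+* _)
    have hf (a : K) : f (algebraMap K E a) = algebraMap K _ a := rfl
    -- Comparison takes place in a finite level E containing x, where the stability result applies.
    have hstab (W : ValuationSubring (maximalPExtension p K))
        (hW : ∀ a, algebraMap K _ a ∈ W ↔ v a ≤ 1) (σ : Gal(E/K)) :
        σ • W.comap f = W.comap f := by
      refine ValuationSubring.smul_eq_of_forall_exists_pow_sub p v hE h _ (fun a ha ↦ ?_) σ
      rw [ValuationSubring.mem_comap, hf, hW]
      exact ha
    have := ValuationSubring.le_of_forall_smul_eq (hstab W₂ h₂) (hstab W₁ h₁) (fun a ha ↦ by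
      rw [ValuationSubring.mem_comap, hf] at ha ⊢
      rwa [h₂, ← h₁])
    exact this (x := ⟨x, hxE⟩) hx
  obtain ⟨W, hW⟩ := v.exists_hasExtension (maximalPExtension p K)
  exact ⟨W, hW, fun W' hW' ↦ (hle W' W hW' hW).antisymm (hle W W' hW hW')⟩

theorem mainTheorem1 (p : ℕ) [Fact p.Prime] {K Γ₀ : Type*} [Field K] [CharP K p]
    [LinearOrderedCommGroupWithZero Γ₀] (v : Valuation K Γ₀) :
    IsPHenselian p v ↔ {x : K | v x < 1} ⊆ {y : K | ∃ x : K, x ^ p - x = y} :=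
  ⟨fun h _ ha ↦ exists_pow_sub_self_eq_of_isPHenselian h ha,
    fun h ↦ isPHenselian_of_forall_exists_pow_sub_self_eq fun _ ha ↦ h ha⟩
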